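/- **Theorem (Gaussian concentration inequality).** Let $\Lambda$ be a finite set and let $q\in\mathbb{N}$. Associate to each $x\in\Lambda$ the Hilbert space $\mathcal{H}_x=\mathbb{C}^q$, and let $\mathcal{H}_\Lambda=\bigotimes_{x\in\Lambda}\mathcal{H}_x$. For $\Lambda'\subseteq\Lambda$, let $\mathcal{O}_{\Lambda'}$ be the set of self-adjoint linear operators on $\mathcal{H}_{\Lambda'}$, regarded as operators on $\mathcal{H}_\Lambda$ via $A\mapsto A\otimes\mathbb{I}_{\Lambda\setminus\Lambda'}$. A state is a positive semidefinite operator with unit trace. Let $\omega=\bigotimes_{x\in\Lambda}\omega_x$ be a product state on $\mathcal{H}_\Lambda$, where each $\omega_x$ is a state on $\mathcal{H}_x$, and assume that $\omega$ has full support (i.e., its kernel is trivial). Then, for every $H\in\mathcal{O}_\Lambda$, $$\ln\mathrm{Tr}\,e^{H+\ln\omega}\;\le\;\mathrm{Tr}[\omega H]+\frac12\sum_{x\in\Lambda}(\partial_xH)^2,$$ where, $\|\cdot\|_\infty$ denoting the operator norm, $$\partial_xH=2\min_{A\in\mathcal{O}_{\Lambda\setminus\{x\}}}\|H-A\|_\infty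 .$$ -/

import Mathlib

-- The norm of a complex matrix is its operator norm on the Hilbert space with the Euclidean norm.
open scoped Matrix.Norms.L2Operator

-- The order on `ℂ` in which `0 ≤ z` means that `z` is real and nonnegative.
open scoped ComplexOrder

namespace QuantumSpin

/-- The algebra of linear operators on the Hilbert space `⨂_{x ∈ Λ} ℂ^q` of the spins in `Λ`,
written in the product orthonormal basis, which is indexed by the configurations `Λ → Fin q`. -/
abbrev Op (Λ : Type*) (q : ℕ) : Type _ := Matrix (Λ → Fin q) (Λ → Fin q) ℂ

/-- A quantum state (density matrix): positive semidefinite with unit trace. -/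
def IsState {n : Type*} [Fintype n] (ρ : Matrix n n ℂ) : Prop :=
  ρ.PosSemidef ∧ ρ.trace = 1

/-- The tensor product `⨂_{x ∈ Λ} ρ x` of single-spin operators. -/
def tensorOp {Λ : Type*} [Fintype Λ] {q : ℕ} (ρ : Λ → Matrix (Fin q) (Fin q) ℂ) : Op Λ q :=
  Matrix.of fun σ τ => ∏ x, ρ x (σ x) (τ x)

/-- `ω` is a state on `Λ` that is a tensor product of single-spin states. -/
def IsProductState {Λ : Type*} [Fintype Λ] [DecidableEq Λ] {q : ℕ} (ω : Op Λ q) : Prop :=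
  IsState ω ∧ ∃ ρ : Λ → Matrix (Fin q) (Fin q) ℂ, (∀ x, IsState (ρ x)) ∧ ω = tensorOp ρ

/-- The support of a state is the orthogonal complement of its kernel; it is the whole space
if and only if the kernel is trivial. -/
def HasFullSupport {n : Type*} [Fintype n] [DecidableEq n] (ω : Matrix n n ℂ) : Prop :=
  LinearMap.ker (Matrix.toLin' ω) = ⊥

/-- The canonical embedding `A ↦ A ⊗ 𝟙` of the operators on the spins in `S ⊆ Λ` into the
operators on the spins in `Λ`. -/
def embed {Λ : Type*} [Fintype Λ] [DecidableEq Λ] {q : ℕ} (S : Finset Λ) (A : Op S q) : Op Λ q :=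
  Matrix.of fun σ τ =>
    if ∀ y, y ∉ S → σ y = τ y then A (fun y => σ y) (fun y => τ y) else 0

/-- The dependence `∂ₓ H` of `H` on the site `x`: twice the distance in operator norm from `H` to
the self-adjoint operators acting on the spins other than `x`. The infimum is over a nonempty
family that is bounded below, and it is attained (`exists_siteDep_eq`). -/
noncomputable def siteDep {Λ : Type*} [Fintype Λ] [DecidableEq Λ] {q : ℕ}
    (x : Λ) (H : Op Λ q) : ℝ :=
  2 * ⨅ A : {A : Op (({x}ᶜ : Finset Λ)) q // A.IsHermitian}, ‖H - embed {x}ᶜ A.1‖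

/-- The infimum in the definition of `siteDep` is a minimum. -/
theorem exists_siteDep_eq {Λ : Type*} [Fintype Λ] [DecidableEq Λ] {q : ℕ}
    (x : Λ) (H : Op Λ q) :
    ∃ A : Op (({x}ᶜ : Finset Λ)) q, A.IsHermitian ∧ siteDep x H = 2 * ‖H - embed {x}ᶜ A‖ := by
  let V : Submodule ℝ (Op Λ q) :=
    { carrier := {B | ∃ A : Op (({x}ᶜ : Finset Λ)) q, A.IsHermitian ∧ embed {x}ᶜ A = B}
      zero_mem' := ⟨0, Matrix.isHermitian_zero, by ext σ τ; simp [embed]⟩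
      add_mem' := by
        rintro _ _ ⟨A, hA, rfl⟩ ⟨B, hB, rfl⟩
        refine ⟨A + B, hA.add hB, ?_⟩
        ext σ τ
        simp only [embed, Matrix.of_apply, Matrix.add_apply]
        split_ifs <;> simp
      smul_mem' := by
        rintro c _ ⟨A, hA, rfl⟩
        refine ⟨c • A, ?_, ?_⟩
        · rw [Matrix.IsHermitian, Matrix.conjTranspose_smul, hA.eq, star_trivial]
        · ext σ τ
          simp only [embed, Matrix.of_apply, Matrix.smul_apply]
          split_ifs <;> simp }
  have hc : IsClosed (V : Set (Op Λ q)) := V.closed_of_finiteDimensional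
  have : ProperSpace (Op Λ q) := FiniteDimensional.proper ℝ (Op Λ q)
  obtain ⟨_, ⟨A, hA, rfl⟩, hd⟩ := hc.exists_infDist_eq_dist ⟨0, V.zero_mem⟩ H
  refine ⟨A, hA, ?_⟩
  unfold siteDep
  congr 1
  have : Nonempty {A : Op (({x}ᶜ : Finset Λ)) q // A.IsHermitian} := ⟨⟨A, hA⟩⟩
  refine le_antisymm (ciInf_le ⟨0, ?_⟩ (⟨A, hA⟩ : {A : Op _ q // A.IsHermitian}))
    (le_ciInf fun B => ?_)
  · rintro _ ⟨B, rfl⟩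
    exact norm_nonneg _
  · rw [← dist_eq_norm, ← dist_eq_norm, ← hd]
    exact Metric.infDist_le_dist_of_mem ⟨B.1, B.2, rfl⟩

end QuantumSpin

/-! The sites are averaged out one at a time, each at the cost of a factor `cosh (∂ₓH)`. Let `E` be
the average of `H` over site `x` against `ωₓ`, and let `D = H - E`. If `A` is an optimal
approximation of `H` that acts trivially on `x`, then averaging fixes `A` and contracts the distance
to it, so `‖D‖ ≤ 2‖H - A‖ = ∂ₓH`. Golden–Thompson gives `Tr e^(H + ln ω) ≤ Tr (e^(E + ln ω) e^D)`,
and convexity of the exponential gives `e^D ≤ cosh (∂ₓH) + c D`. As `ln ω` is a sum over sites,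
`e^(E + ln ω)` is `ωₓ` times an operator commuting with everything on `x`; hence its trace against
`D` vanishes and only the `cosh` survives.

Averaging at one site does not increase the distance to the operators trivial on another, so the
step can be iterated with the original `∂ₓH` (`exists_commute_re_trace_exp_le`). Once all sites are
averaged, `H` has become the scalar `Tr (ω H)`, and `cosh t ≤ e^(t²/2)` finishes the proof. -/

namespace QuantumSpin

open Filter Topology NormedSpace Matrix

/-! ### Lie product formula -/

section LieProduct

variable {𝔸 : Type*} [NormedRing 𝔸] [NormOneClass 𝔸]

theorem norm_pow_sub_pow_le {X Y : 𝔸} {c : ℝ} (hX : ‖X‖ ≤ c) (hY : ‖Y‖ ≤ c) (n : ℕ) :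
    ‖X ^ (n + 1) - Y ^ (n + 1)‖ ≤ (n + 1) * c ^ n * ‖X - Y‖ := by
  have hc : 0 ≤ c := (norm_nonneg X).trans hX
  induction n with
  | zero => simp
  | succ n ih =>
    have h : X ^ (n + 1 + 1) - Y ^ (n + 1 + 1)
        = X * (X ^ (n + 1) - Y ^ (n + 1)) + (X - Y) * Y ^ (n + 1) := by
      rw [pow_succ' X (n + 1), pow_succ' Y (n + 1)]; noncomm_ring
    calc ‖X ^ (n + 1 + 1) - Y ^ (n + 1 + 1)‖
        ≤ ‖X‖ * ‖X ^ (n + 1) - Y ^ (n + 1)‖ + ‖X - Y‖ * ‖Y ^ (n + 1)‖ := by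
          rw [h]
          exact (norm_add_le _ _).trans (add_le_add (norm_mul_le _ _) (norm_mul_le _ _))
      _ ≤ c * ((n + 1) * c ^ n * ‖X - Y‖) + ‖X - Y‖ * c ^ (n + 1) := by
          have := (norm_pow_le Y (n + 1)).trans (pow_le_pow_left₀ (norm_nonneg _) hY _)
          gcongr
      _ = _ := by push_cast; ring

variable [NormedAlgebra ℝ 𝔸]

theorem norm_exp_le_exp_norm (A : 𝔸) : ‖exp A‖ ≤ Real.exp ‖A‖ := by
  rw [Real.exp_eq_exp_ℝ, exp_eq_tsum ℝ, exp_eq_tsum ℝ]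
  refine (norm_tsum_le_tsum_norm (norm_expSeries_summable' (𝕂 := ℝ) A)).trans ?_
  refine Summable.tsum_le_tsum (fun n => ?_) (norm_expSeries_summable' (𝕂 := ℝ) A)
    (expSeries_summable' (𝕂 := ℝ) ‖A‖)
  rw [norm_smul, Real.norm_of_nonneg (by positivity), smul_eq_mul]
  gcongr
  exact norm_pow_le A n

variable [CompleteSpace 𝔸]

/-- The Lie product formula. -/
theorem tendsto_exp_mul_exp_pow (A B : 𝔸) :
    Tendsto (fun n : ℕ => (exp ((n : ℝ)⁻¹ • A) * exp ((n : ℝ)⁻¹ • B)) ^ n) atTop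
      (𝓝 (exp (A + B))) := by
  -- Both `f` and its derivative vanish at `0`, so `N * ‖f (1/N)‖ → 0`; this beats the factor `N`
  -- from comparing `N`-th powers.
  let f : ℝ → 𝔸 := fun t => exp (t • A) * exp (t • B) - exp (t • (A + B))
  have hf : HasDerivAt f 0 0 := by
    have h := ((hasDerivAt_exp_smul_const (𝕂 := ℝ) A 0).mul
      (hasDerivAt_exp_smul_const (𝕂 := ℝ) B 0)).sub
      (hasDerivAt_exp_smul_const (𝕂 := ℝ) (A + B) 0)
    refine (h.congr_deriv ?_).congr_of_eventuallyEq (Eventually.of_forall fun t => rfl)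
    simp
  have hinv : Tendsto (fun n : ℕ => ((n + 1 : ℕ) : ℝ)⁻¹) atTop (𝓝[≠] 0) := by
    refine tendsto_nhdsWithin_iff.2 ⟨?_, Eventually.of_forall fun n => ?_⟩
    · exact (tendsto_inv_atTop_nhds_zero_nat (𝕜 := ℝ)).comp (tendsto_add_atTop_nat 1)
    · simp only [Set.mem_compl_iff, Set.mem_singleton_iff]; positivity
  have hslope : Tendsto (fun n : ℕ => ((n + 1 : ℕ) : ℝ) * ‖f ((n + 1 : ℕ) : ℝ)⁻¹‖) atTop (𝓝 0) := by
    have h := ((hasDerivAt_iff_tendsto_slope.1 hf).comp hinv).norm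
    rw [norm_zero] at h
    refine h.congr fun n => ?_
    have h0 : f 0 = 0 := by simp [f]
    simp only [Function.comp_apply, slope_def_module, h0, sub_zero, inv_inv, norm_smul]
    rw [Real.norm_of_nonneg (by positivity)]
  rw [← tendsto_add_atTop_iff_nat 1, tendsto_iff_norm_sub_tendsto_zero]
  refine squeeze_zero (fun _ => norm_nonneg _) (fun n => ?_)
    ((hslope.const_mul (Real.exp (‖A‖ + ‖B‖))).trans (by simp))
  set N : ℝ := ((n + 1 : ℕ) : ℝ) with hN
  have hN0 : 0 < N := by rw [hN]; positivity
  have hnorm (C : 𝔸) : ‖exp (N⁻¹ • C)‖ ≤ Real.exp (N⁻¹ * ‖C‖) := by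
    refine (norm_exp_le_exp_norm _).trans_eq ?_
    rw [norm_smul, Real.norm_of_nonneg (by positivity)]
  have hexp : exp (A + B) = exp (N⁻¹ • (A + B)) ^ (n + 1) := by
    let _ : NormedAlgebra ℚ 𝔸 := NormedAlgebra.restrictScalars ℚ ℝ 𝔸
    rw [← NormedSpace.exp_nsmul, ← Nat.cast_smul_eq_nsmul ℝ, smul_smul, ← hN, mul_inv_cancel₀ hN0.ne',
      one_smul]
  have hX : ‖exp (N⁻¹ • A) * exp (N⁻¹ • B)‖ ≤ Real.exp (N⁻¹ * (‖A‖ + ‖B‖)) := by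
    rw [mul_add, Real.exp_add]
    exact (norm_mul_le _ _).trans (mul_le_mul (hnorm A) (hnorm B) (norm_nonneg _) (by positivity))
  have hY : ‖exp (N⁻¹ • (A + B))‖ ≤ Real.exp (N⁻¹ * (‖A‖ + ‖B‖)) := by
    refine (hnorm _).trans (Real.exp_le_exp.2 ?_)
    gcongr
    exact norm_add_le A B
  rw [hexp]
  refine (norm_pow_sub_pow_le hX hY n).trans ?_
  have hpow : Real.exp (N⁻¹ * (‖A‖ + ‖B‖)) ^ n ≤ Real.exp (‖A‖ + ‖B‖) := by
    rw [← Real.exp_nat_mul, Real.exp_le_exp, ← mul_assoc]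
    refine mul_le_of_le_one_left (by positivity) ?_
    rw [← div_eq_mul_inv, div_le_one hN0, hN]
    push_cast
    linarith
  have hN' : (n : ℝ) + 1 = N := by rw [hN]; push_cast; rfl
  rw [hN']
  calc N * Real.exp (N⁻¹ * (‖A‖ + ‖B‖)) ^ n *
        ‖exp (N⁻¹ • A) * exp (N⁻¹ • B) - exp (N⁻¹ • (A + B))‖
      ≤ N * Real.exp (‖A‖ + ‖B‖) * ‖f N⁻¹‖ := by gcongr
    _ = Real.exp (‖A‖ + ‖B‖) * (N * ‖f N⁻¹‖) := by ring

end LieProduct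

/-! ### Golden–Thompson inequality -/

section GoldenThompson

variable {n : Type*} [Fintype n]

theorem trace_mul_pow_comm [DecidableEq n] (X Y : Matrix n n ℂ) (m : ℕ) :
    ((X * Y) ^ m).trace = ((Y * X) ^ m).trace := by
  cases m with
  | zero => simp
  | succ m =>
    have h : (X * Y) ^ (m + 1) = X * (Y * X) ^ m * Y := by
      induction m with
      | zero => simp
      | succ m ih => rw [pow_succ, ih, pow_succ]; simp only [mul_assoc]
    rw [h, mul_assoc, Matrix.trace_mul_comm, mul_assoc, pow_succ]

theorem re_trace_mul_conjTranspose (A : Matrix n n ℂ) :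
    (A * Aᴴ).trace.re = ∑ i, ∑ j, ‖A i j‖ ^ 2 := by
  simp [Matrix.trace, Matrix.mul_apply, Complex.mul_conj, Complex.normSq_eq_norm_sq]
  norm_cast

theorem norm_trace_mul_le (A B : Matrix n n ℂ) :
    ‖(A * B).trace‖ ≤ ((A * Aᴴ).trace.re + (B * Bᴴ).trace.re) / 2 := by
  rw [re_trace_mul_conjTranspose, re_trace_mul_conjTranspose,
    Finset.sum_comm (f := fun i j => ‖B i j‖ ^ 2),
    ← Finset.sum_add_distrib, Finset.sum_div]
  refine (norm_sum_le _ _).trans (Finset.sum_le_sum fun i _ => ?_)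
  rw [Matrix.diag_apply, Matrix.mul_apply, ← Finset.sum_add_distrib, Finset.sum_div]
  refine (norm_sum_le _ _).trans (Finset.sum_le_sum fun j _ => ?_)
  rw [norm_mul]
  linarith [two_mul_le_add_sq ‖A i j‖ ‖B j i‖]

variable [DecidableEq n]

/-- The two bounds feed each other in a joint induction. The first at `k + 1` is the first at `k`
for `M ^ 2`, then cyclicity, the second at `k` for `Mᴴ * M` and `M * Mᴴ`, and Cauchy–Schwarz. The
second at `k + 1` is the first at `k` for `P * Q`, then the second at `k` for `P ^ 2` and `Q ^ 2`.
-/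
theorem trace_pow_two_pow_bounds (k : ℕ) :
    (∀ M : Matrix n n ℂ, ‖(M ^ 2 ^ (k + 1)).trace‖ ≤ ((M * Mᴴ) ^ 2 ^ k).trace.re) ∧
    ∀ P Q : Matrix n n ℂ, P.IsHermitian → Q.IsHermitian →
      ((P * Q) ^ 2 ^ k).trace.re ≤ (P ^ 2 ^ k * Q ^ 2 ^ k).trace.re := by
  induction k with
  | zero =>
    refine ⟨fun M => ?_, fun P Q _ _ => by simp⟩
    have := norm_trace_mul_le M M
    simpa [sq] using this
  | succ k ih =>
    obtain ⟨hW, hG⟩ := ih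
    refine ⟨fun M => ?_, fun P Q hP hQ => ?_⟩
    · have hP : (Mᴴ * M).IsHermitian := Matrix.isHermitian_conjTranspose_mul_self M
      have hQ : (M * Mᴴ).IsHermitian := Matrix.isHermitian_mul_conjTranspose_self M
      calc ‖(M ^ 2 ^ (k + 1 + 1)).trace‖ = ‖((M ^ 2) ^ 2 ^ (k + 1)).trace‖ := by
            rw [← pow_mul, ← pow_succ']
        _ ≤ ((M ^ 2 * (M ^ 2)ᴴ) ^ 2 ^ k).trace.re := hW _
        _ = ((Mᴴ * M * (M * Mᴴ)) ^ 2 ^ k).trace.re := by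
            have h : M ^ 2 * (M ^ 2)ᴴ = (M * (M * Mᴴ)) * Mᴴ := by
              simp only [sq, Matrix.conjTranspose_mul, mul_assoc]
            rw [h, trace_mul_pow_comm, mul_assoc]
        _ ≤ _ := hG _ _ hP hQ
        _ ≤ _ := Complex.re_le_norm _
        _ ≤ _ := norm_trace_mul_le _ _
        _ = ((M * Mᴴ) ^ 2 ^ (k + 1)).trace.re := by
            rw [(hP.pow _).eq, (hQ.pow _).eq, ← pow_add, ← pow_add, ← two_mul, ← pow_succ',
              trace_mul_pow_comm Mᴴ M, add_self_div_two]
    · calc ((P * Q) ^ 2 ^ (k + 1)).trace.re ≤ _ := Complex.re_le_norm _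
        _ ≤ (((P * Q) * (P * Q)ᴴ) ^ 2 ^ k).trace.re := hW _
        _ = ((P ^ 2 * Q ^ 2) ^ 2 ^ k).trace.re := by
            have h : (P * Q) * (P * Q)ᴴ = (P * Q ^ 2) * P := by
              simp only [sq, Matrix.conjTranspose_mul, hP.eq, hQ.eq, mul_assoc]
            rw [h, trace_mul_pow_comm, sq P, mul_assoc]
        _ ≤ _ := hG _ _ (hP.pow 2) (hQ.pow 2)
        _ = _ := by rw [← pow_mul, ← pow_mul, ← pow_succ']

/-- The Golden–Thompson inequality. -/
theorem re_trace_exp_add_le {A B : Matrix n n ℂ} (hA : A.IsHermitian) (hB : B.IsHermitian) :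
    (exp (A + B)).trace.re ≤ (exp A * exp B).trace.re := by
  cases isEmpty_or_nonempty n
  · simp [Matrix.trace]
  -- The trace bound covers exponents `2 ^ k` only, so the limit is taken along that subsequence.
  have hlim := (tendsto_exp_mul_exp_pow A B).comp
    (tendsto_pow_atTop_atTop_of_one_lt (one_lt_two : (1 : ℕ) < 2))
  have hcont : Continuous fun M : Matrix n n ℂ => M.trace.re :=
    Complex.continuous_re.comp (Continuous.matrix_trace continuous_id)
  refine le_of_tendsto ((hcont.tendsto _).comp hlim) (Eventually.of_forall fun k => ?_)
  have hherm {C : Matrix n n ℂ} (hC : C.IsHermitian) (r : ℝ) : (exp (r • C)).IsHermitian :=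
    Matrix.IsHermitian.exp (hC.smul (IsSelfAdjoint.all r))
  have hpow (C : Matrix n n ℂ) : exp ((((2 ^ k : ℕ) : ℝ))⁻¹ • C) ^ 2 ^ k = exp C := by
    rw [← Matrix.exp_nsmul, ← Nat.cast_smul_eq_nsmul ℝ, smul_smul, mul_inv_cancel₀ (by positivity),
      one_smul]
  have := (trace_pow_two_pow_bounds k).2 _ _ (hherm hA ((2 ^ k : ℕ) : ℝ)⁻¹)
    (hherm hB ((2 ^ k : ℕ) : ℝ)⁻¹)
  rw [hpow, hpow] at this
  exact this

end GoldenThompson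

open scoped MatrixOrder

/-! ### Chord bound for the exponential of a bounded Hermitian matrix -/

section ExpBound

variable {n : Type*} [Fintype n] [DecidableEq n]

theorem exists_exp_le_cosh_add_mul {d : ℝ} (hd : 0 ≤ d) :
    ∃ c : ℝ, ∀ t ∈ Set.Icc (-d) d, Real.exp t ≤ Real.cosh d + c * t := by
  rcases hd.eq_or_lt with rfl | hd
  · exact ⟨0, fun t ht => by simp [le_antisymm ht.2 (by simpa using ht.1)]⟩
  -- On `[-d, d]` the convex function `exp` lies below its chord, which has slope `sinh d / d` and
  -- value `cosh d` at `0`.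
  · refine ⟨Real.sinh d / d, fun t ht => ?_⟩
    have hconv := convexOn_exp.2
    have h := hconv (Set.mem_univ (-d)) (Set.mem_univ d)
      (show 0 ≤ (d - t) / (2 * d) from div_nonneg (by linarith [ht.2]) (by linarith))
      (show 0 ≤ (d + t) / (2 * d) from div_nonneg (by linarith [ht.1]) (by linarith))
      (by field_simp; ring)
    simp only [smul_eq_mul] at h
    have h1 : (d - t) / (2 * d) * -d + (d + t) / (2 * d) * d = t := by field_simp; ring
    rw [h1] at h
    refine h.trans_eq ?_
    rw [Real.cosh_eq, Real.sinh_eq]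
    field_simp
    ring

theorem exists_exp_le_cosh_add_smul {d : ℝ} (hd : 0 ≤ d) :
    ∃ c : ℝ, ∀ D : Matrix n n ℂ, -algebraMap ℝ _ d ≤ D → D ≤ algebraMap ℝ _ d →
      D.IsHermitian → exp D ≤ algebraMap ℝ _ (Real.cosh d) + c • D := by
  obtain ⟨c, hc⟩ := exists_exp_le_cosh_add_mul hd
  refine ⟨c, fun D h1 h2 hD => ?_⟩
  have hD' : IsSelfAdjoint D := hD
  rw [← map_neg, algebraMap_le_iff_le_spectrum hD'] at h1
  rw [le_algebraMap_iff_spectrum_le hD'] at h2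
  rw [← CFC.real_exp_eq_normedSpace_exp hD', ← cfc_const_mul_id c D hD',
    ← cfc_const_add (Real.cosh d) (fun x => c * x) D (by fun_prop) hD']
  exact cfc_mono (fun x hx => hc x ⟨h1 x hx, h2 x hx⟩) (by fun_prop) (by fun_prop)

theorem re_trace_mul_le_of_le {P X Y : Matrix n n ℂ} (hP : P.PosSemidef) (h : X ≤ Y) :
    (P * X).trace.re ≤ (P * Y).trace.re := by
  obtain ⟨R, rfl⟩ := CStarAlgebra.nonneg_iff_eq_star_mul_self.mp hP.nonneg
  have h0 := ((Matrix.le_iff.1 h).mul_mul_conjTranspose_same R).trace_nonneg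
  rw [Matrix.trace_mul_comm, ← mul_assoc, mul_sub, Matrix.trace_sub] at h0
  have := (Complex.le_def.1 h0).1
  rw [Complex.zero_re, Complex.sub_re] at this
  exact sub_nonneg.1 this

end ExpBound

/-! ### Conditional expectation and the one-site estimate -/

section CondExp

variable {m n : Type*} [Fintype m] [DecidableEq m] [Fintype n] [DecidableEq n]
variable (s : Matrix m m ℂ →⋆ₐ[ℂ] Matrix n n ℂ) (S : Matrix m m ℂ)

/-- The conditional expectation onto the commutant of the range of `s` which is given by the
density matrix `S * S`, in Kraus form. -/
noncomputable def condExp (X : Matrix n n ℂ) : Matrix n n ℂ :=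
  ∑ a, ∑ c, s (single c a 1 * S) * X * s (S * single a c 1)

theorem sum_single_mul_mul_single (M : Matrix m m ℂ) :
    ∑ a, ∑ c, single c a (1 : ℂ) * M * single a c 1 = M.trace • (1 : Matrix m m ℂ) := by
  simp only [single_mul_mul_single, one_mul, mul_one]
  rw [Finset.sum_congr rfl fun a _ => show ∑ c, single c c (M a a) = M a a • (1 : Matrix m m ℂ) from ?_,
    ← Finset.sum_smul]
  · rfl
  · ext i j
    by_cases h : i = j
    · simp [Matrix.sum_apply, single_apply, h]
    · have (c : m) : ¬(c = i ∧ c = j) := fun hc => h (hc.1.symm.trans hc.2)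
      simp [Matrix.sum_apply, h, this]

theorem condExp_sub (X Y : Matrix n n ℂ) :
    condExp s S (X - Y) = condExp s S X - condExp s S Y := by
  simp only [condExp, mul_sub, sub_mul, Finset.sum_sub_distrib]

variable {s S}

theorem condExp_of_commute (htr : (S * S).trace = 1) {B : Matrix n n ℂ}
    (hB : ∀ M, Commute (s M) B) : condExp s S B = B := by
  have h (a c : m) : s (single c a 1 * S) * B * s (S * single a c 1)
      = B * s (single c a (1 : ℂ) * (S * S) * single a c 1) := by
    rw [(hB _).eq, mul_assoc, ← map_mul]
    simp only [mul_assoc]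
  simp only [condExp, h, ← Finset.mul_sum, ← map_sum]
  rw [sum_single_mul_mul_single, htr, one_smul, map_one, mul_one]

theorem commute_condExp (M : Matrix m m ℂ) (X : Matrix n n ℂ) :
    Commute (s M) (condExp s S X) := by
  induction M using Matrix.induction_on' with
  | h_zero => simp
  | h_add p q hp hq => rw [map_add]; exact hp.add_left hq
  | h_std_basis e f x =>
    have hx : single e f x = x • single e f (1 : ℂ) := by simp
    rw [hx, map_smul]
    refine Commute.smul_left ?_ x
    have hl (a c : m) : s (single e f 1) * (s (single c a 1 * S) * X * s (S * single a c 1))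
        = if c = f then s (single e a 1 * S) * X * s (S * single a f 1) else 0 := by
      simp only [← mul_assoc, ← map_mul]
      split_ifs with h
      · subst h; simp
      · simp [single_mul_single_of_ne _ _ _ _ (Ne.symm h)]
    have hr (a c : m) : s (single c a 1 * S) * X * s (S * single a c 1) * s (single e f 1)
        = if c = e then s (single e a 1 * S) * X * s (S * single a f 1) else 0 := by
      simp only [mul_assoc, ← map_mul]
      split_ifs with h
      · subst h; simp
      · simp [single_mul_single_of_ne _ _ _ _ h]
    rw [Commute, SemiconjBy, condExp]
    simp only [Finset.mul_sum, Finset.sum_mul, hl, hr, Finset.sum_ite_eq', Finset.mem_univ, if_true]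

theorem commute_condExp_right {T X : Matrix n n ℂ} (hT : ∀ M, Commute T (s M)) (hX : Commute T X) :
    Commute T (condExp s S X) :=
  Commute.sum_right _ _ _ fun _ _ => Commute.sum_right _ _ _ fun _ _ =>
    ((hT _).mul_right hX).mul_right (hT _)

/-- Cyclicity moves the Kraus factors onto the weight; summing over matrix units turns the inner `S
* S` into its trace, which is `1`, and leaves the weight unchanged. -/
theorem trace_mul_condExp (htr : (S * S).trace = 1) {B : Matrix n n ℂ}
    (hB : ∀ M, Commute (s M) B) (X : Matrix n n ℂ) :
    (B * s (S * S) * condExp s S X).trace = (B * s (S * S) * X).trace := by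
  have h (a c : m) : (B * s (S * S) * (s (single c a 1 * S) * X * s (S * single a c 1))).trace
      = (B * s (S * (single a c (1 : ℂ) * (S * S) * single c a 1) * S) * X).trace := by
    rw [← mul_assoc, Matrix.trace_mul_comm, ← mul_assoc, ← mul_assoc, ← mul_assoc, (hB _).eq,
      mul_assoc B, ← map_mul, mul_assoc B, ← map_mul]
    simp only [mul_assoc]
  have h2 : ∑ a, ∑ c, S * (single a c (1 : ℂ) * (S * S) * single c a 1) * S = S * S := by
    simp only [← Finset.sum_mul, ← Finset.mul_sum]
    rw [Finset.sum_comm, sum_single_mul_mul_single, htr, one_smul, mul_one]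
  simp only [condExp, Finset.mul_sum, Matrix.trace_sum, h]
  simp only [← Matrix.trace_sum, ← Finset.sum_mul, ← Finset.mul_sum, ← map_sum]
  simp only [Finset.sum_mul, Finset.mul_sum, h2]

theorem conjTranspose_map_mul_single (hS : S.IsHermitian) (a c : m) :
    s (single c a 1 * S) = (s (S * single a c 1))ᴴ := by
  rw [← Matrix.star_eq_conjTranspose, ← map_star, Matrix.star_eq_conjTranspose,
    conjTranspose_mul, hS.eq, conjTranspose_single, star_one]

theorem posSemidef_condExp (hS : S.IsHermitian) {X : Matrix n n ℂ} (hX : X.PosSemidef) :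
    (condExp s S X).PosSemidef := by
  refine posSemidef_sum _ fun a _ => posSemidef_sum _ fun c _ => ?_
  rw [conjTranspose_map_mul_single hS]
  exact hX.conjTranspose_mul_mul_same _

theorem isHermitian_condExp (hS : S.IsHermitian) {X : Matrix n n ℂ} (hX : X.IsHermitian) :
    (condExp s S X).IsHermitian := by
  simp only [IsHermitian, condExp, conjTranspose_sum]
  refine Finset.sum_congr rfl fun a _ => Finset.sum_congr rfl fun c _ => ?_
  rw [conjTranspose_map_mul_single hS]
  simp only [conjTranspose_mul, conjTranspose_conjTranspose, hX.eq, mul_assoc]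

theorem condExp_mono (hS : S.IsHermitian) {X Y : Matrix n n ℂ} (h : X ≤ Y) :
    condExp s S X ≤ condExp s S Y := by
  rw [Matrix.le_iff, ← condExp_sub]
  exact posSemidef_condExp hS h

theorem condExp_algebraMap (htr : (S * S).trace = 1) (r : ℝ) :
    condExp s S (algebraMap ℝ _ r) = algebraMap ℝ _ r :=
  condExp_of_commute htr fun _ => (Algebra.commutes r _).symm

/-- `X` is at distance at most `r` from `A`, in the order of Hermitian matrices. -/
def Near (r : ℝ) (X A : Matrix n n ℂ) : Prop :=
  -algebraMap ℝ _ r ≤ X - A ∧ X - A ≤ algebraMap ℝ _ r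

theorem near_condExp (hS : S.IsHermitian) (htr : (S * S).trace = 1) {r : ℝ}
    {X A : Matrix n n ℂ} (h : Near r X A) :
    Near r (condExp s S X) (condExp s S A) := by
  rw [Near, ← condExp_sub, ← map_neg, ← condExp_algebraMap (s := s) htr r,
    ← condExp_algebraMap (s := s) htr (-r)]
  refine ⟨condExp_mono hS ?_, condExp_mono hS h.2⟩
  rw [map_neg]
  exact h.1

theorem map_exp (ℓ : Matrix m m ℂ) : s (exp ℓ) = exp (s ℓ) := by
  have hs : Continuous s := s.toAlgHom.toLinearMap.continuous_of_finiteDimensional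
  let _ : NormedAlgebra ℚ (Matrix m m ℂ) := NormedAlgebra.restrictScalars ℚ ℂ _
  exact NormedSpace.map_exp (s : Matrix m m ℂ →+* Matrix n n ℂ) hs ℓ

/-- Here `s ℓ` plays the logarithm of the state at the averaged site and `L` that of the other
sites. The weight `exp (E + (L + s ℓ))` factors as `exp (E + L) * s (S * S)`, which makes the linear
term of the chord bound disappear. -/
theorem re_trace_exp_add_le_cosh_mul (hS : S.IsHermitian) (htr : (S * S).trace = 1)
    {ℓ : Matrix m m ℂ} (hℓ : exp ℓ = S * S) {L : Matrix n n ℂ} (hL : ∀ M, Commute (s M) L)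
    (hLH : (L + s ℓ).IsHermitian) {H A : Matrix n n ℂ} (hH : H.IsHermitian)
    (hA : ∀ M, Commute (s M) A) {r : ℝ} (hr : 0 ≤ r) (h : Near r H A) :
    (exp (H + (L + s ℓ))).trace.re ≤
      Real.cosh (2 * r) * (exp (condExp s S H + (L + s ℓ))).trace.re := by
  set E := condExp s S H with hE
  have hEH : E.IsHermitian := isHermitian_condExp hS hH
  have hEA : Near r E A := by
    simpa only [condExp_of_commute htr hA] using near_condExp (s := s) hS htr h
  have hK : (E + (L + s ℓ)).IsHermitian := hEH.add hLH
  have hDH : (H - E).IsHermitian := hH.sub hEH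
  have hEc : ∀ M, Commute (s M) (E + L) := fun M => (commute_condExp M H).add_right (hL M)
  have hBc : ∀ M, Commute (s M) (exp (E + L)) := fun M => (hEc M).exp_right
  have hexp : exp (E + (L + s ℓ)) = exp (E + L) * s (S * S) := by
    rw [← add_assoc, Matrix.exp_add_of_commute _ _ (hEc ℓ).symm, ← map_exp, hℓ]
  have h2r : algebraMap ℝ (Matrix n n ℂ) (2 * r) = algebraMap ℝ _ r + algebraMap ℝ _ r := by
    rw [two_mul, map_add]
  obtain ⟨c, hc⟩ := exists_exp_le_cosh_add_smul (n := n) (d := 2 * r) (by positivity)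
  -- Triangle inequality: `H` and `E` are both within `r` of `A`.
  have hD := hc (H - E)
    (by
      have := add_le_add h.1 (neg_le_neg hEA.2)
      rw [h2r]
      convert this using 1 <;> abel)
    (by
      have := add_le_add h.2 (neg_le_neg hEA.1)
      rw [h2r]
      convert this using 1 <;> abel) hDH
  have hpos : (exp (E + (L + s ℓ))).PosSemidef := (IsSelfAdjoint.exp_nonneg hK).posSemidef
  have hzero : (exp (E + (L + s ℓ)) * (H - E)).trace = 0 := by
    rw [hexp, mul_sub, Matrix.trace_sub, trace_mul_condExp htr hBc, sub_self]
  calc (exp (H + (L + s ℓ))).trace.re = (exp ((E + (L + s ℓ)) + (H - E))).trace.re := by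
        congr 3; abel
    _ ≤ (exp (E + (L + s ℓ)) * exp (H - E)).trace.re := re_trace_exp_add_le hK hDH
    _ ≤ _ := re_trace_mul_le_of_le hpos hD
    _ = _ := by
        rw [mul_add, Matrix.trace_add, Matrix.mul_smul, Matrix.trace_smul, hzero, smul_zero,
          add_zero, Algebra.algebraMap_eq_smul_one, Matrix.mul_smul, mul_one, Matrix.trace_smul,
          Complex.smul_re, smul_eq_mul]

end CondExp

/-! ### Single-site operators and tensor products -/

section Site

variable {Λ : Type*} [Fintype Λ] {q : ℕ}

theorem tensorOp_one : tensorOp (1 : Λ → Matrix (Fin q) (Fin q) ℂ) = 1 := by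
  ext i j
  simp only [tensorOp, Matrix.of_apply, Pi.one_apply, one_apply, Finset.prod_ite_zero,
    Finset.mem_univ, true_implies, Finset.prod_const_one, funext_iff]

theorem tensorOp_single (σ τ : Λ → Fin q) :
    tensorOp (fun x => single (σ x) (τ x) (1 : ℂ)) = single σ τ 1 := by
  ext i j
  simp only [tensorOp, Matrix.of_apply, single_apply, Finset.prod_ite_zero, Finset.mem_univ,
    true_implies, Finset.prod_const_one, funext_iff, forall_and]

variable [DecidableEq Λ]

theorem tensorOp_mul_tensorOp (ρ σ : Λ → Matrix (Fin q) (Fin q) ℂ) :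
    tensorOp ρ * tensorOp σ = tensorOp fun x => ρ x * σ x := by
  ext i j
  simp only [tensorOp, Matrix.mul_apply, Matrix.of_apply, ← Finset.prod_mul_distrib]
  rw [Finset.prod_univ_sum, Fintype.piFinset_univ]

theorem tensorOp_update_one_apply (x : Λ) (M : Matrix (Fin q) (Fin q) ℂ) (σ τ : Λ → Fin q) :
    tensorOp (Function.update 1 x M) σ τ
      = if ∀ y, y ≠ x → σ y = τ y then M (σ x) (τ x) else 0 := by
  have h : ∏ y ∈ Finset.univ.erase x, (Function.update 1 x M : Λ → Matrix _ _ ℂ) y (σ y) (τ y)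
      = ∏ y ∈ Finset.univ.erase x, if σ y = τ y then (1 : ℂ) else 0 :=
    Finset.prod_congr rfl fun y hy => by
      rw [Function.update_of_ne (Finset.ne_of_mem_erase hy), Pi.one_apply, one_apply]
  rw [tensorOp, Matrix.of_apply, ← Finset.mul_prod_erase _ _ (Finset.mem_univ x), h,
    Finset.prod_ite_zero]
  simp

/-- The embedding of the operators on the spin at `x` as operators on all spins. -/
noncomputable def siteOp (x : Λ) : Matrix (Fin q) (Fin q) ℂ →⋆ₐ[ℂ] Op Λ q where
  toFun M := tensorOp (Function.update 1 x M)
  map_one' := by rw [show (1 : Matrix (Fin q) (Fin q) ℂ) = (1 : Λ → Matrix _ _ ℂ) x from rfl,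
    Function.update_eq_self, tensorOp_one]
  map_mul' M N := by
    rw [tensorOp_mul_tensorOp]
    congr 1
    ext1 y
    rcases eq_or_ne y x with rfl | hy
    · simp
    · simp [hy]
  map_zero' := by ext σ τ; simp [tensorOp_update_one_apply]
  map_add' M N := by
    ext σ τ
    simp only [tensorOp_update_one_apply, Matrix.add_apply]
    split_ifs <;> simp
  commutes' r := by
    ext σ τ
    have h : σ = τ ↔ (∀ y, y ≠ x → σ y = τ y) ∧ σ x = τ x :=
      ⟨by rintro rfl; simp, fun h => funext fun y =>
        (eq_or_ne y x).elim (fun hy => hy ▸ h.2) (h.1 y)⟩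
    simp only [tensorOp_update_one_apply, Matrix.algebraMap_matrix_apply, h, ite_and]
  map_star' M := by
    ext σ τ
    simp only [tensorOp_update_one_apply, Matrix.star_apply, apply_ite star, star_zero,
      eq_comm (a := σ _)]

theorem siteOp_apply (x : Λ) (M : Matrix (Fin q) (Fin q) ℂ) :
    siteOp x M = tensorOp (Function.update 1 x M) := rfl

theorem commute_siteOp_siteOp {x y : Λ} (hxy : x ≠ y) (M N : Matrix (Fin q) (Fin q) ℂ) :
    Commute (siteOp x M) (siteOp y N) := by
  rw [Commute, SemiconjBy, siteOp_apply, siteOp_apply, tensorOp_mul_tensorOp, tensorOp_mul_tensorOp]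
  congr 1
  ext1 z
  rcases eq_or_ne z x with rfl | hx
  · simp [hxy]
  · simp [hx]

theorem siteOp_mul_tensorOp_update (x : Λ) (M : Matrix (Fin q) (Fin q) ℂ)
    (ρ : Λ → Matrix (Fin q) (Fin q) ℂ) :
    siteOp x M * tensorOp (Function.update ρ x 1) = tensorOp (Function.update ρ x M) := by
  rw [siteOp_apply, tensorOp_mul_tensorOp]
  congr 1
  ext1 y
  rcases eq_or_ne y x with rfl | hy
  · simp
  · simp [hy]

theorem tensorOp_ite_insert {x : Λ} {T : Finset Λ} (hx : x ∉ T)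
    (ρ : Λ → Matrix (Fin q) (Fin q) ℂ) :
    tensorOp (fun y => if y ∈ insert x T then ρ y else 1)
      = siteOp x (ρ x) * tensorOp (fun y => if y ∈ T then ρ y else 1) := by
  rw [siteOp_apply, tensorOp_mul_tensorOp]
  congr 1
  ext1 y
  rcases eq_or_ne y x with rfl | hy
  · simp [hx]
  · simp [hy]

theorem commute_tensorOp {X : Op Λ q} (hX : ∀ x M, Commute (siteOp x M) X)
    (ρ : Λ → Matrix (Fin q) (Fin q) ℂ) : Commute (tensorOp ρ) X := by
  suffices h : ∀ T : Finset Λ, Commute (tensorOp fun y => if y ∈ T then ρ y else 1) X by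
    simpa using h Finset.univ
  intro T
  induction T using Finset.induction_on with
  | empty =>
    simp only [Finset.notMem_empty, if_false]
    exact (tensorOp_one (Λ := Λ) (q := q)).symm ▸ Commute.one_left X
  | insert x T hx ih =>
    rw [tensorOp_ite_insert hx]
    exact (hX x _).mul_left ih

/-- Every matrix unit is a tensor product of single-site matrix units, so `X` commutes with all of
them and is central. -/
theorem exists_eq_scalar_of_commute {X : Op Λ q} (hX : ∀ x M, Commute (siteOp x M) X) :
    ∃ c : ℂ, X = algebraMap ℂ _ c := by
  obtain ⟨c, hc⟩ := mem_range_scalar_of_commute_single (M := X) fun i j _ => by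
    beta_reduce
    rw [← tensorOp_single]
    exact commute_tensorOp hX _
  exact ⟨c, hc.symm⟩

theorem exp_sum_siteOp (ℓ : Λ → Matrix (Fin q) (Fin q) ℂ) :
    exp (∑ x, siteOp x (ℓ x)) = tensorOp fun x => exp (ℓ x) := by
  suffices h : ∀ T : Finset Λ, exp (∑ x ∈ T, siteOp x (ℓ x))
      = tensorOp fun y => if y ∈ T then exp (ℓ y) else 1 by
    simpa using h Finset.univ
  intro T
  induction T using Finset.induction_on with
  | empty =>
    simp only [Finset.notMem_empty, if_false, Finset.sum_empty, exp_zero]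
    exact tensorOp_one.symm
  | insert x T hx ih =>
    rw [tensorOp_ite_insert hx (fun y => exp (ℓ y)), Finset.sum_insert hx,
      Matrix.exp_add_of_commute, ih, map_exp]
    exact Commute.sum_right _ _ _ fun y hy =>
      commute_siteOp_siteOp (by rintro rfl; exact hx hy) _ _

theorem siteOp_injective [Nonempty (Λ → Fin q)] (x : Λ) :
    Function.Injective (siteOp x : Matrix (Fin q) (Fin q) ℂ → Op Λ q) := by
  intro M N h
  obtain ⟨σ⟩ := ‹Nonempty (Λ → Fin q)›
  ext i j
  have h2 := congrFun₂ h (Function.update σ x i) (Function.update σ x j)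
  have h3 : ∀ y, y ≠ x → Function.update σ x i y = Function.update σ x j y := fun y hy => by
    simp [hy]
  simpa only [siteOp_apply, tensorOp_update_one_apply, if_pos h3, Function.update_self] using h2

/-- A kernel vector `v` of `M` gives `M * (v v*) = 0`; invertibility of `siteOp x M` would then
annihilate the image of `v v* ≠ 0`, against injectivity. -/
theorem isUnit_of_isUnit_siteOp [Nonempty (Λ → Fin q)] {x : Λ} {M : Matrix (Fin q) (Fin q) ℂ}
    (h : IsUnit (siteOp x M)) : IsUnit M := by
  by_contra hM
  rw [isUnit_iff_isUnit_det, isUnit_iff_ne_zero, not_not] at hM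
  obtain ⟨v, hv, hMv⟩ := exists_mulVec_eq_zero_iff.2 hM
  have h0 : siteOp x (vecMulVec v (star v)) = (0 : Op Λ q) := by
    rw [← h.mul_right_eq_zero, ← map_mul, mul_vecMulVec, hMv, zero_vecMulVec, map_zero]
  rw [← map_zero (siteOp x)] at h0
  obtain ⟨i, hi⟩ := Function.ne_iff.1 hv
  have := congrFun₂ (siteOp_injective x h0) i i
  simp [vecMulVec_apply] at this
  exact hi this

theorem isUnit_of_isUnit_tensorOp [Nonempty (Λ → Fin q)] {ρ : Λ → Matrix (Fin q) (Fin q) ℂ}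
    (h : IsUnit (tensorOp ρ)) (x : Λ) : IsUnit (ρ x) := by
  have h1 := siteOp_mul_tensorOp_update x (ρ x) ρ
  rw [Function.update_eq_self] at h1
  rw [← h1, isUnit_iff_isUnit_det, det_mul] at h
  refine isUnit_of_isUnit_siteOp (x := x) ?_
  rw [isUnit_iff_isUnit_det]
  exact isUnit_of_mul_isUnit_left h

theorem isHermitian_embed {T : Finset Λ} {A : Op T q} (hA : A.IsHermitian) :
    (embed T A).IsHermitian := by
  ext σ τ
  simp only [conjTranspose_apply, embed, Matrix.of_apply, apply_ite star, star_zero, hA.apply,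
    eq_comm (a := σ _)]

theorem commute_siteOp_embed (x : Λ) (M : Matrix (Fin q) (Fin q) ℂ)
    (A : Op (({x}ᶜ : Finset Λ)) q) : Commute (siteOp x M) (embed {x}ᶜ A) := by
  have hr (σ : Λ → Fin q) (a : Fin q) :
      (fun y : (({x}ᶜ : Finset Λ)) => Function.update σ x a y) = fun y : (({x}ᶜ : Finset Λ)) => σ y :=
    funext fun y => Function.update_of_ne (by
      have := y.2
      rwa [Finset.mem_compl, Finset.mem_singleton] at this) _ _
  have hx {y : Λ} : y ∉ ({x}ᶜ : Finset Λ) ↔ y = x := by simp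
  ext σ τ
  simp only [Matrix.mul_apply, siteOp_apply, tensorOp_update_one_apply, embed, Matrix.of_apply, hx,
    forall_eq]
  -- In either product only one intermediate configuration contributes: one factor changes only the
  -- spin at `x`, the other preserves it.
  rw [Finset.sum_eq_single (Function.update σ x (τ x)),
    Finset.sum_eq_single (Function.update τ x (σ x))]
  · have h1 : ∀ y, y ≠ x → σ y = Function.update σ x (τ x) y := fun y hy => by simp [hy]
    have h2 : ∀ y, y ≠ x → Function.update τ x (σ x) y = τ y := fun y hy => by simp [hy]
    simp only [hr, Function.update_self, if_pos h1, if_pos h2, if_true, mul_comm]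
  · intro κ _ hκ
    by_cases h1 : σ x = κ x
    · rw [if_neg (c := ∀ y, y ≠ x → κ y = τ y), mul_zero]
      refine fun h => hκ (funext fun y => ?_)
      rcases eq_or_ne y x with rfl | hy
      · simp [h1]
      · simp [hy, h y hy]
    · rw [if_neg h1, zero_mul]
  · simp
  · intro κ _ hκ
    by_cases h1 : κ x = τ x
    · rw [if_neg (c := ∀ y, y ≠ x → σ y = κ y), zero_mul]
      refine fun h => hκ (funext fun y => ?_)
      rcases eq_or_ne y x with rfl | hy
      · simp [h1]
      · simp [hy, h y hy]
    · rw [if_neg h1, mul_zero]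
  · simp

end Site

/-! ### Iteration over the sites and conclusion -/

section Concentration

variable {Λ : Type*} [Fintype Λ] [DecidableEq Λ] {q : ℕ}

theorem exists_near (x : Λ) {H : Op Λ q} (hH : H.IsHermitian) :
    ∃ A : Op Λ q, (∀ M, Commute (siteOp x M) A) ∧ Near (siteDep x H / 2) H A := by
  obtain ⟨A, hA, hAd⟩ := exists_siteDep_eq x H
  have hs : IsSelfAdjoint (H - embed {x}ᶜ A) := hH.sub (isHermitian_embed hA)
  refine ⟨embed {x}ᶜ A, fun M => commute_siteOp_embed x M A, ?_⟩
  rw [hAd, mul_div_cancel_left₀ _ two_ne_zero]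
  exact ⟨hs.neg_algebraMap_norm_le_self, hs.le_algebraMap_norm_self⟩

theorem siteDep_nonneg (x : Λ) (H : Op Λ q) : 0 ≤ siteDep x H :=
  mul_nonneg zero_le_two (Real.iInf_nonneg fun _ => norm_nonneg _)

/-- Averaging the sites of `T` one after the other. -/
theorem exists_commute_re_trace_exp_le {ℓ S : Λ → Matrix (Fin q) (Fin q) ℂ}
    (hℓ : ∀ x, (ℓ x).IsHermitian) (hS : ∀ x, (S x).IsHermitian)
    (htr : ∀ x, (S x * S x).trace = 1) (hexp : ∀ x, exp (ℓ x) = S x * S x)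
    {H : Op Λ q} (hH : H.IsHermitian) (T : Finset Λ) :
    ∃ G : Op Λ q, G.IsHermitian ∧ (∀ x ∈ T, ∀ M, Commute (siteOp x M) G) ∧
      (exp (∑ x, siteOp x (ℓ x)) * G).trace = (exp (∑ x, siteOp x (ℓ x)) * H).trace ∧
      (∀ x, ∃ A : Op Λ q, (∀ M, Commute (siteOp x M) A) ∧ Near (siteDep x H / 2) G A) ∧
      (exp (H + ∑ x, siteOp x (ℓ x))).trace.re ≤
        (∏ x ∈ T, Real.cosh (siteDep x H)) * (exp (G + ∑ x, siteOp x (ℓ x))).trace.re := by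
  induction T using Finset.induction_on with
  | empty => exact ⟨H, hH, by simp, rfl, fun x => exists_near x hH, by simp⟩
  | insert x T hx ih =>
    obtain ⟨G, hG, hcomm, htrace, hnear, hle⟩ := ih
    have hsH (y : Λ) : (siteOp y (ℓ y) : Op Λ q).IsHermitian := by
      rw [IsHermitian, ← star_eq_conjTranspose, ← map_star, star_eq_conjTranspose, (hℓ y).eq]
    have hLH : (∑ y, siteOp y (ℓ y) : Op Λ q).IsHermitian := by
      rw [IsHermitian, conjTranspose_sum]
      exact Finset.sum_congr rfl fun y _ => hsH y
    have hsum : ∑ y, siteOp y (ℓ y) = ∑ y ∈ Finset.univ.erase x, siteOp y (ℓ y) + siteOp x (ℓ x) :=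
      (Finset.sum_erase_add _ _ (Finset.mem_univ x)).symm
    have hLc (M) : Commute (siteOp x M) (∑ y ∈ Finset.univ.erase x, siteOp y (ℓ y)) :=
      Commute.sum_right _ _ _ fun y hy => commute_siteOp_siteOp (Finset.ne_of_mem_erase hy).symm _ _
    refine ⟨condExp (siteOp x) (S x) G, isHermitian_condExp (hS x) hG, ?_, ?_, ?_, ?_⟩
    · intro y hy M
      rcases eq_or_ne y x with rfl | hyx
      · exact commute_condExp _ _
      · exact commute_condExp_right (fun N => commute_siteOp_siteOp hyx M N)
          (hcomm y (Finset.mem_of_mem_insert_of_ne hy hyx) M)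
    · rw [← htrace, hsum, Matrix.exp_add_of_commute _ _ (hLc _).symm, ← map_exp, hexp,
        trace_mul_condExp (htr x) fun M => (hLc M).exp_right]
    -- Averaging at `x` preserves commutation with the operators on `y`, so the averaged `A`
    -- witnesses the same radius: the dependences stay those of the original `H`.
    · intro y
      obtain ⟨A, hA, hGA⟩ := hnear y
      refine ⟨condExp (siteOp x) (S x) A, fun M => ?_, near_condExp (hS x) (htr x) hGA⟩
      rcases eq_or_ne y x with rfl | hyx
      · exact commute_condExp _ _
      · exact commute_condExp_right (fun N => commute_siteOp_siteOp hyx M N) (hA M)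
    · obtain ⟨A, hA, hGA⟩ := hnear x
      have h := re_trace_exp_add_le_cosh_mul (hS x) (htr x) (hexp x) hLc (hsum ▸ hLH) hG hA
        (div_nonneg (siteDep_nonneg x H) zero_le_two) hGA
      rw [mul_div_cancel₀ _ two_ne_zero, ← hsum] at h
      refine hle.trans ?_
      rw [Finset.prod_insert hx, mul_comm (Real.cosh _), mul_assoc]
      exact mul_le_mul_of_nonneg_left h (Finset.prod_nonneg fun y _ => (Real.cosh_pos _).le)

theorem re_trace_exp_pos {n : Type*} [Fintype n] [DecidableEq n] [Nonempty n]
    {X : Matrix n n ℂ} (hX : X.IsHermitian) : 0 < (exp X).trace.re := by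
  have h : (exp X).PosDef :=
    (IsSelfAdjoint.exp_nonneg hX).posSemidef.posDef_iff_isUnit.2 (Matrix.isUnit_exp X)
  exact (Complex.lt_def.1 h.trace_pos).1

theorem re_trace_exp_add_log_le
    {ω : Op Λ q} (hω : IsProductState ω) (hfull : HasFullSupport ω)
    {H : Op Λ q} (hH : H.IsHermitian) :
    (exp (H + CFC.log ω)).trace.re ≤
      Real.exp ((ω * H).trace.re + (1 / 2) * ∑ x, siteDep x H ^ 2) := by
  obtain ⟨⟨hpos, htrω⟩, ρ, hρ, rfl⟩ := hω
  have hne : Nonempty (Λ → Fin q) := by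
    by_contra h
    rw [not_nonempty_iff] at h
    simp [Matrix.trace] at htrω
  have hunit : IsUnit (tensorOp ρ) := by
    rw [← Matrix.isUnit_toLin'_iff]
    exact (LinearMap.isUnit_iff_ker_eq_bot _).2 hfull
  have hexp (x : Λ) : exp (CFC.log (ρ x)) = ρ x :=
    CFC.exp_log _ ((hρ x).1.posDef_iff_isUnit.2 (isUnit_of_isUnit_tensorOp hunit x)).isStrictlyPositive
  have hsq (x : Λ) : CFC.sqrt (ρ x) * CFC.sqrt (ρ x) = ρ x :=
    CFC.sqrt_mul_sqrt_self _ (hρ x).1.nonneg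
  obtain ⟨G, hG', hcomm, htrace, -, hle⟩ := exists_commute_re_trace_exp_le
    (ℓ := fun x => CFC.log (ρ x)) (S := fun x => CFC.sqrt (ρ x)) (fun x => IsSelfAdjoint.log)
    (fun x => (CFC.sqrt_nonneg (ρ x)).isSelfAdjoint) (fun x => by rw [hsq, (hρ x).2])
    (fun x => by rw [hsq, hexp]) hH Finset.univ
  have hL : exp (∑ x, siteOp x (CFC.log (ρ x))) = tensorOp ρ := by
    rw [exp_sum_siteOp]
    simp only [hexp]
  have hlog : CFC.log (tensorOp ρ) = ∑ x, siteOp x (CFC.log (ρ x)) := by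
    rw [← hL]
    exact CFC.log_exp _ (isSelfAdjoint_sum _ fun x _ => IsSelfAdjoint.log.map (siteOp x))
  obtain ⟨c, rfl⟩ := exists_eq_scalar_of_commute fun x M => hcomm x (Finset.mem_univ x) M
  rw [hL] at htrace
  have hc : c = (tensorOp ρ * H).trace := by
    rw [← htrace, Algebra.algebraMap_eq_smul_one, Matrix.mul_smul, mul_one, Matrix.trace_smul,
      htrω, smul_eq_mul, mul_one]
  have hG : (exp (algebraMap ℂ (Op Λ q) c + ∑ x, siteOp x (CFC.log (ρ x)))).trace.re
      ≤ Real.exp (tensorOp ρ * H).trace.re := by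
    rw [Matrix.exp_add_of_commute _ _ (Algebra.commute_algebraMap_left c _), hL, ← algebraMap_exp_comm,
      Algebra.algebraMap_eq_smul_one, Matrix.smul_mul, one_mul, Matrix.trace_smul, htrω, smul_eq_mul,
      mul_one, ← Complex.exp_eq_exp_ℂ, ← hc, ← Complex.norm_exp]
    -- The scalar `c` is only known as a complex number, so the bound goes through `‖exp c‖ = exp
    -- (re c)`.
    exact Complex.re_le_norm _
  rw [hlog, add_comm (tensorOp ρ * H).trace.re, Real.exp_add, Finset.mul_sum, Real.exp_sum]
  refine hle.trans (mul_le_mul ?_ hG ?_ (by positivity))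
  · refine Finset.prod_le_prod (fun x _ => (Real.cosh_pos _).le) fun x _ => ?_
    refine (Real.cosh_le_exp_half_sq _).trans_eq ?_
    rw [div_eq_inv_mul, one_div]
  · rw [← hlog]
    exact (re_trace_exp_pos (hG'.add IsSelfAdjoint.log)).le

end Concentration

end QuantumSpin

theorem mainTheorem5 {Λ : Type*} [Fintype Λ] [DecidableEq Λ] (q : ℕ)
    (ω : QuantumSpin.Op Λ q) (hω : QuantumSpin.IsProductState ω)
    (hfull : QuantumSpin.HasFullSupport ω)
    (H : QuantumSpin.Op Λ q) (hH : H.IsHermitian) :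
    Real.log (Matrix.trace (NormedSpace.exp (H + CFC.log ω))).re ≤
      (Matrix.trace (ω * H)).re + (1 / 2) * ∑ x, (QuantumSpin.siteDep x H) ^ 2 := by
  have hne : Nonempty (Λ → Fin q) := by
    by_contra h
    rw [not_nonempty_iff] at h
    simpa [Matrix.trace] using hω.1.2
  rw [Real.log_le_iff_le_exp (QuantumSpin.re_trace_exp_pos (hH.add IsSelfAdjoint.log))]
  exact QuantumSpin.re_trace_exp_add_log_le hω hfull hH
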